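/- Let $K$ be an algebraically closed field. All algebras are associative and not necessarily unital. A formal deformation of a $K$-algebra $B$ is a pair $(X,\Phi)$ where $X$ is an associative $K[[t]]$-algebra that is torsion-free and $t$-adically complete (and separated) as a $K[[t]]$-module, and $\Phi : K\otimes_{K[[t]]} X \to B$ is an isomorphism of $K$-algebras, where $K$ is a $K[[t]]$-algebra via $t\mapsto 0$. For finite-dimensional associative $K$-algebras $A$ and $B$ write $B\le A$ if there exists a formal deformation $(X,\Phi)$ of $B$ such that $K((t))\otimes_{K[[t]]}X$ and $K((t))\otimes_K A$ are isomorphic as $K((t))$-algebras. This relation depends only on the isomorphism classes of $A$ and $B$. Proposition. The relation $\le$ is a partial order (reflexive, antisymmetric and transitive) on the set of isomorphism classes of finite-dimensional associative $K$-algebras. -/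

import Mathlib

open scoped TensorProduct PowerSeries LaurentSeries

universe u v w

namespace AssocDeformation

/-- Two (possibly non-unital) associative `R`-algebras are isomorphic: there is a multiplicative
`R`-linear equivalence between them. -/
def IsoAlg (R : Type u) [CommRing R]
    (A : Type v) [NonUnitalRing A] [Module R A]
    (B : Type w) [NonUnitalRing B] [Module R B] : Prop :=
  ∃ e : A ≃ₗ[R] B, ∀ x y : A, e (x * y) = e x * e y

/-- The field `K` as a `K⟦X⟧`-algebra through evaluation at zero. -/
noncomputable abbrev evalZeroAlgebra (K : Type u) [Field K] : Algebra K⟦X⟧ K :=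
  (PowerSeries.constantCoeff (R := K)).toAlgebra

section Deformation

attribute [local instance] evalZeroAlgebra

/-- A formal deformation of the associative `K`-algebra `A`: a complete (and separated) and
torsion-free associative `K⟦X⟧`-algebra together with an isomorphism of `K`-algebras from its
specialization at zero, `K ⊗[K⟦X⟧] carrier`, onto `A`. Algebras need not have a unit. -/
structure FormalDeformation (K : Type u) [Field K]
    (A : Type v) [NonUnitalRing A] [Module K A] [IsScalarTower K A A] [SMulCommClass K A A] where
  /-- the underlying set of the deformation -/
  carrier : Type (max u v)
  [ring : NonUnitalRing carrier]
  [module : Module K⟦X⟧ carrier]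
  [isScalarTower : IsScalarTower K⟦X⟧ carrier carrier]
  [smulCommClass : SMulCommClass K⟦X⟧ carrier carrier]
  complete : IsAdicComplete (Ideal.span {(PowerSeries.X : K⟦X⟧)}) carrier
  torsionFree : Module.IsTorsionFree K⟦X⟧ carrier
  /-- the identification of the special fibre with `A` -/
  special : (K ⊗[K⟦X⟧] carrier) ≃ₗ[K] A
  special_mul : ∀ x y : K ⊗[K⟦X⟧] carrier, special (x * y) = special x * special y

attribute [instance] FormalDeformation.ring FormalDeformation.module
  FormalDeformation.isScalarTower FormalDeformation.smulCommClass

end Deformation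

/-- The Laurent series field as a `K`-algebra, with `K` acting coefficientwise. -/
noncomputable abbrev laurentAlgebra (K : Type u) [Field K] : Algebra K K⸨X⸩ :=
  HahnSeries.instAlgebra

section Relation

attribute [local instance] laurentAlgebra

/-- The relation `B ≤ A`: some formal deformation of `B` becomes isomorphic to `A` over the field
of Laurent series. -/
def DeformsTo (K : Type u) [Field K]
    (B : Type v) [NonUnitalRing B] [Module K B] [IsScalarTower K B B] [SMulCommClass K B B]
    (A : Type w) [NonUnitalRing A] [Module K A] [IsScalarTower K A A] [SMulCommClass K A A] :
    Prop :=
  ∃ D : FormalDeformation K B, IsoAlg K⸨X⸩ (K⸨X⸩ ⊗[K⟦X⟧] D.carrier) (K⸨X⸩ ⊗[K] A)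

/-- A finite-dimensional associative `K`-algebra, not necessarily unital. -/
structure FinDimAlg (K : Type u) [Field K] where
  /-- the underlying set of the algebra -/
  carrier : Type v
  [ring : NonUnitalRing carrier]
  [module : Module K carrier]
  [isScalarTower : IsScalarTower K carrier carrier]
  [smulCommClass : SMulCommClass K carrier carrier]
  [finite : FiniteDimensional K carrier]

attribute [instance] FinDimAlg.ring FinDimAlg.module FinDimAlg.isScalarTower
  FinDimAlg.smulCommClass FinDimAlg.finite

section Iso

variable {R : Type u} [CommRing R]

theorem IsoAlg.refl (A : Type v) [NonUnitalRing A] [Module R A] : IsoAlg R A A :=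
  ⟨LinearEquiv.refl R A, fun _ _ => rfl⟩

theorem IsoAlg.symm {A : Type v} [NonUnitalRing A] [Module R A]
    {B : Type w} [NonUnitalRing B] [Module R B] (h : IsoAlg R A B) : IsoAlg R B A := by
  obtain ⟨e, he⟩ := h
  refine ⟨e.symm, fun x y => e.injective ?_⟩
  simp [he]

theorem IsoAlg.trans {A : Type*} [NonUnitalRing A] [Module R A]
    {B : Type*} [NonUnitalRing B] [Module R B] {C : Type*} [NonUnitalRing C] [Module R C]
    (h : IsoAlg R A B) (h' : IsoAlg R B C) : IsoAlg R A C := by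
  obtain ⟨e, he⟩ := h
  obtain ⟨f, hf⟩ := h'
  exact ⟨e.trans f, fun x y => by simp [he, hf]⟩

theorem IsoAlg.baseChange (S : Type*) [CommRing S] [Algebra R S]
    {A : Type v} [NonUnitalRing A] [Module R A] [IsScalarTower R A A] [SMulCommClass R A A]
    {B : Type w} [NonUnitalRing B] [Module R B] [IsScalarTower R B B] [SMulCommClass R B B]
    (h : IsoAlg R A B) : IsoAlg S (S ⊗[R] A) (S ⊗[R] B) := by
  obtain ⟨e, he⟩ := h
  refine ⟨TensorProduct.AlgebraTensorModule.congr (LinearEquiv.refl S S) e, fun x y => ?_⟩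
  induction x with
  | zero => simp
  | add x₁ x₂ h₁ h₂ => simp only [add_mul, map_add, h₁, h₂]
  | tmul s a =>
    induction y with
    | zero => simp
    | add y₁ y₂ h₁ h₂ => simp only [mul_add, map_add, h₁, h₂]
    | tmul s' a' => simp [Algebra.TensorProduct.tmul_mul_tmul, he]

end Iso

/-- Isomorphism of finite-dimensional algebras, as an equivalence relation. -/
def isoSetoid (K : Type u) [Field K] : Setoid (FinDimAlg.{u, v} K) where
  r A B := IsoAlg K A.carrier B.carrier
  iseqv := ⟨fun A => IsoAlg.refl A.carrier, fun h => h.symm, fun h h' => h.trans h'⟩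

/-- The isomorphism classes of finite-dimensional associative `K`-algebras. -/
def IsoClass (K : Type u) [Field K] : Type (max u (v + 1)) :=
  Quotient (isoSetoid.{u, v} K)

theorem DeformsTo.congr {K : Type u} [Field K] {B B' A A' : FinDimAlg.{u, v} K}
    (hB : IsoAlg K B.carrier B'.carrier) (hA : IsoAlg K A.carrier A'.carrier)
    (h : DeformsTo K B.carrier A.carrier) : DeformsTo K B'.carrier A'.carrier := by
  obtain ⟨D, hD⟩ := h
  obtain ⟨e, he⟩ := hB
  refine ⟨{ carrier := D.carrier
            complete := D.complete
            torsionFree := D.torsionFree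
            special := D.special.trans e
            special_mul := fun x y => ?_ }, hD.trans (hA.baseChange K⸨X⸩)⟩
  simp [D.special_mul, he]

end Relation

/-- The relation `≤` on isomorphism classes: `le [B] [A]` means `B ≤ A`. -/
def IsoClass.le {K : Type u} [Field K] (b a : IsoClass.{u, v} K) : Prop :=
  Quotient.liftOn₂ b a (fun B A => DeformsTo K B.carrier A.carrier)
    (fun _ _ _ _ hB hA => propext
      ⟨DeformsTo.congr hB hA, DeformsTo.congr (IsoAlg.symm hB) (IsoAlg.symm hA)⟩)

end AssocDeformation

/-!
Both algebras are encoded by structure constants, on which `GL` acts by change of basis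
(`transport`). A formal deformation of `B` is free over `K⟦X⟧`, with a basis lifting any given basis
of `B` (`exists_basis_lift`), and conversely integral structure constants span a lattice
(`Degenerates.exists_lattice`). Hence `B ≤ A` holds exactly when some point of the `GL(K⸨X⸩)`-orbit
of `A` has coordinates in `K⟦X⟧` and specializes to `B` at `X = 0` (`DeformsTo.degenerates`,
`Degenerates.deformsTo`). Reflexivity is then witnessed by the identity matrix.

Transitivity (`Degenerates.trans`) holds over every field: if `h` degenerates `B` to `C` and `g`
degenerates `A` to `B`, then for large `N` the matrix `h(X) g(X ^ N)` degenerates `A` to `C`, because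
`g(X ^ N) • A` agrees with `B` modulo `X ^ N`, and the poles of `h` have bounded order.

For antisymmetry, `B ≤ A` implies that the polynomials vanishing on the orbit of `A` also vanish on
the orbit of `B` (`Degenerates.ker_orbitMap_le`). If also `A ≤ B`, the orbits have the same closure.
Two orbits with the same closure meet: the fibre product of the two orbit maps over the closure is a
nonempty scheme of finite type, so over an algebraically closed field it has a rational point
(`exists_algHom_comp_eq`). This replaces the usual comparison of the dimensions of orbits and needs
no openness of an orbit in its closure.
-/

namespace AssocDeformation

open Module Matrix
open scoped Kronecker

/-! ### Structure constants and change of basis -/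

section StructConst

variable {ι : Type*} [Fintype ι] {R : Type*} [CommRing R]

/-- The action of `GL` on structure constants. If `P * Q = 1` and `c` lists the structure constants
of a basis `b`, then `transport P Q c` lists those of the basis `i ↦ ∑ a, P i a • b a`. The inverse
`Q` is a separate argument, so that no division occurs and every ring homomorphism commutes with
the construction; the defining expression makes sense for arbitrary `P` and `Q`. -/
def transport (P Q : Matrix ι ι R) (c : Matrix (ι × ι) ι R) : Matrix (ι × ι) ι R :=
  (P ⊗ₖ P) * c * Q

theorem transport_one [DecidableEq ι] (c : Matrix (ι × ι) ι R) : transport 1 1 c = c := by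
  simp [transport]

theorem transport_transport (P Q P' Q' : Matrix ι ι R) (c : Matrix (ι × ι) ι R) :
    transport P' Q' (transport P Q c) = transport (P' * P) (Q * Q') c := by
  simp only [transport, Matrix.mul_kronecker_mul, Matrix.mul_assoc]

theorem transport_map {S : Type*} [CommRing S] (f : R →+* S) (P Q : Matrix ι ι R)
    (c : Matrix (ι × ι) ι R) :
    (transport P Q c).map f = transport (P.map f) (Q.map f) (c.map f) := by
  simp only [transport, Matrix.map_mul]
  congr 2
  ext
  simp

theorem transport_add (P Q : Matrix ι ι R) (c d : Matrix (ι × ι) ι R) :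
    transport P Q (c + d) = transport P Q c + transport P Q d := by
  simp [transport, Matrix.mul_add, Matrix.add_mul]

theorem transport_smul (r : R) (P Q : Matrix ι ι R) (c : Matrix (ι × ι) ι R) :
    transport P Q (r • c) = r • transport P Q c := by
  simp [transport]

theorem transport_smul_smul (r s : R) (P Q : Matrix ι ι R) (c : Matrix (ι × ι) ι R) :
    transport (r • P) (s • Q) c = (r * r * s) • transport P Q c := by
  simp only [transport, Matrix.smul_kronecker, Matrix.kronecker_smul, Matrix.smul_mul,
    Matrix.mul_smul, smul_smul]
  congr 1
  ring

theorem transport_apply (P Q : Matrix ι ι R) (c : Matrix (ι × ι) ι R) (i j k : ι) :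
    transport P Q c (i, j) k = ∑ a, ∑ b, ∑ l, P i a * P j b * c (a, b) l * Q l k := by
  simp only [transport, Matrix.mul_apply, Fintype.sum_prod_type, Matrix.kroneckerMap_apply,
    Finset.sum_mul]
  rw [Finset.sum_comm]
  refine Finset.sum_congr rfl fun a _ => ?_
  rw [Finset.sum_comm]

variable {M : Type*} [NonUnitalRing M] [Module R M]

/-- The structure constants of an algebra in a basis `b`, as a matrix whose rows are indexed by pairs:
`b i * b j = ∑ k, structConst b (i, j) k • b k`. -/
noncomputable def structConst (b : Basis ι R M) : Matrix (ι × ι) ι R :=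
  Matrix.of fun p k => b.repr (b p.1 * b p.2) k

theorem basis_mul_basis (b : Basis ι R M) (i j : ι) :
    b i * b j = ∑ k, structConst b (i, j) k • b k :=
  (b.sum_repr (b i * b j)).symm

theorem structConst_eq {b : Basis ι R M} {c : Matrix (ι × ι) ι R}
    (h : ∀ i j, b i * b j = ∑ k, c (i, j) k • b k) : structConst b = c := by
  ext ⟨i, j⟩ k
  simp only [structConst, Matrix.of_apply, h]
  exact congrFun (b.repr_sum_self (c (i, j))) k

theorem structConst_map {N : Type*} [NonUnitalRing N] [Module R N] (b : Basis ι R M)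
    (e : M ≃ₗ[R] N) (he : ∀ x y, e (x * y) = e x * e y) :
    structConst (b.map e) = structConst b :=
  structConst_eq fun i j => by simp [← he, basis_mul_basis b i j]

variable [IsScalarTower R M M] [SMulCommClass R M M]

theorem isoAlg_of_structConst_eq {N : Type*} [NonUnitalRing N] [Module R N]
    [IsScalarTower R N N] [SMulCommClass R N N] (b : Basis ι R M) (d : Basis ι R N)
    (h : structConst b = structConst d) : IsoAlg R M N := by
  refine ⟨b.equiv d (Equiv.refl ι), fun x y => ?_⟩
  rw [← b.sum_repr x, ← b.sum_repr y]
  simp only [Finset.sum_mul_sum, map_sum, smul_mul_smul_comm, map_smul, Basis.equiv_apply,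
    Equiv.refl_apply]
  refine Finset.sum_congr rfl fun i _ => Finset.sum_congr rfl fun j _ => ?_
  rw [basis_mul_basis b, basis_mul_basis d, h]
  simp

theorem structConst_baseChange (S : Type*) [CommRing S] [Algebra R S] (b : Basis ι R M) :
    structConst (b.baseChange S) = (structConst b).map (algebraMap R S) :=
  structConst_eq fun i j => by
    simp only [Basis.baseChange_apply, Algebra.TensorProduct.tmul_mul_tmul, basis_mul_basis b,
      TensorProduct.tmul_sum, mul_one, Matrix.map_apply]
    exact Finset.sum_congr rfl fun k _ => by
      rw [TensorProduct.tmul_smul, algebraMap_smul]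

theorem structConst_eq_transport {b d : Basis ι R M} {P Q : Matrix ι ι R}
    (hP : ∀ i, d i = ∑ a, P i a • b a) (hQ : ∀ a, b a = ∑ i, Q a i • d i) :
    structConst d = transport P Q (structConst b) :=
  structConst_eq fun i j => by
    have hl : ∀ l, (b l : M) = ∑ k, Q l k • d k := hQ
    have hb : ∀ a a', b a * b a' = ∑ l, ∑ k, (structConst b (a, a') l * Q l k) • d k := by
      intro a a'
      rw [basis_mul_basis b]
      refine Finset.sum_congr rfl fun l _ => ?_
      rw [hl l, Finset.smul_sum]
      simp [smul_smul]
    rw [hP i, hP j, Finset.sum_mul_sum]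
    simp only [smul_mul_smul_comm, hb, transport_apply, Finset.smul_sum, smul_smul,
      Finset.sum_smul, mul_assoc]
    rw [Finset.sum_comm (s := Finset.univ (α := ι)) (t := Finset.univ (α := ι))
      (f := fun k a => ∑ a', ∑ l, (P i a * (P j a' * (structConst b (a, a') l * Q l k))) • d k)]
    refine Finset.sum_congr rfl fun a _ => ?_
    rw [Finset.sum_comm (s := Finset.univ (α := ι)) (t := Finset.univ (α := ι))
      (f := fun k a' => ∑ l, (P i a * (P j a' * (structConst b (a, a') l * Q l k))) • d k)]
    refine Finset.sum_congr rfl fun a' _ => ?_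
    exact Finset.sum_comm

theorem exists_structConst_eq_transport [DecidableEq ι] (b d : Basis ι R M) :
    ∃ P Q : Matrix ι ι R, P * Q = 1 ∧ structConst d = transport P Q (structConst b) := by
  refine ⟨(b.toMatrix d)ᵀ, (d.toMatrix b)ᵀ, ?_, structConst_eq_transport (fun i => ?_)
    fun i => ?_⟩
  · rw [← Matrix.transpose_mul, Basis.toMatrix_mul_toMatrix_flip, Matrix.transpose_one]
  · exact (b.sum_toMatrix_smul_self d i).symm
  · exact (d.sum_toMatrix_smul_self b i).symm

theorem exists_basis_structConst_eq_transport [DecidableEq ι] (b : Basis ι R M)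
    {P Q : Matrix ι ι R} (h : P * Q = 1) :
    ∃ d : Basis ι R M, structConst d = transport P Q (structConst b) := by
  have h' : Q * P = 1 := mul_eq_one_comm.1 h
  let d : Basis ι R M := .ofEquivFun (b.equivFun.trans (Matrix.toLinearEquivRight'OfInv h h'))
  have hd : ∀ i, d i = ∑ a, P i a • b a := fun i => by
    simp [d, Basis.coe_ofEquivFun, Matrix.toLinearEquivRight'OfInv, Basis.equivFun_symm_apply]
  refine ⟨d, structConst_eq_transport hd fun a => ?_⟩
  simp only [hd, Finset.smul_sum, smul_smul]
  rw [Finset.sum_comm]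
  simp only [← Finset.sum_smul, ← Matrix.mul_apply, h', Matrix.one_apply, ite_smul, one_smul,
    zero_smul, Finset.sum_ite_eq, Finset.mem_univ, if_true]

end StructConst

/-! ### Complete modules over power series -/

section Lattice

variable {ι : Type*} [Finite ι] {R : Type*} [CommRing R] {I : Ideal R}
  {M : Type*} [AddCommGroup M] [Module R M]

theorem smodEq_iff_repr (b : Basis ι R M) (J : Ideal R) (x y : M) :
    x ≡ y [SMOD (J • ⊤ : Submodule R M)] ↔
      ∀ i, b.repr x i ≡ b.repr y i [SMOD (J • ⊤ : Submodule R R)] := by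
  cases nonempty_fintype ι
  refine ⟨fun h i => ?_, fun h => ?_⟩
  · have h' := (h.map (b.coord i)).mono (U₂ := J • ⊤)
      (Submodule.map_smul'' J ⊤ (b.coord i) ▸ Submodule.smul_mono le_rfl le_top)
    simpa using h'
  · rw [← b.sum_repr x, ← b.sum_repr y]
    refine SModEq.sum fun i _ => ?_
    have h' := (h i).map (LinearMap.toSpanSingleton R M (b i))
    simpa using h'.mono
      (Submodule.map_smul'' J ⊤ (LinearMap.toSpanSingleton R M (b i)) ▸
        Submodule.smul_mono le_rfl le_top)

theorem isAdicComplete_of_basis [IsAdicComplete I R] (b : Basis ι R M) : IsAdicComplete I M := by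
  cases nonempty_fintype ι
  refine { haus' := fun x hx => ?_, prec' := fun f hf => ?_ }
  · refine b.ext_elem fun i => ?_
    refine (IsHausdorff.haus' (I := I) _ fun n => ?_).trans (by simp)
    simpa using (smodEq_iff_repr b _ _ _).1 (hx n) i
  · have h : ∀ i, ∃ y : R, ∀ n, b.repr (f n) i ≡ y [SMOD (I ^ n • ⊤ : Submodule R R)] := fun i =>
      IsPrecomplete.prec' _ fun hmn => (smodEq_iff_repr b _ _ _).1 (hf hmn) i
    choose y hy using h
    refine ⟨∑ i, y i • b i, fun n => (smodEq_iff_repr b _ _ _).2 fun i => ?_⟩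
    rw [b.repr_sum_self]
    exact hy i n

end Lattice

section Special

variable {K : Type u} [Field K] {M : Type*} [AddCommGroup M] [Module K⟦X⟧ M]

attribute [local instance] evalZeroAlgebra

/-- The kernel of the specialization `M → K ⊗ M` at `X = 0` is `X • M`: tensor the exact sequence
`K⟦X⟧ → K⟦X⟧ → K → 0`, whose first map is multiplication by `X`, with `M`. -/
theorem exists_X_smul_of_one_tmul_eq_zero {x : M} (hx : (1 : K) ⊗ₜ[K⟦X⟧] x = 0) :
    ∃ y : M, x = (PowerSeries.X : K⟦X⟧) • y := by
  have hex : Function.Exact (LinearMap.mulLeft K⟦X⟧ (PowerSeries.X : K⟦X⟧))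
      (Algebra.linearMap K⟦X⟧ K) := fun f => by
    change PowerSeries.constantCoeff f = 0 ↔ _
    rw [← PowerSeries.X_dvd_iff]
    exact ⟨fun ⟨g, hg⟩ => ⟨g, hg.symm⟩, fun ⟨g, hg⟩ => ⟨g, hg.symm⟩⟩
  have hsurj : Function.Surjective (Algebra.linearMap K⟦X⟧ K) := fun k =>
    ⟨PowerSeries.C k, PowerSeries.constantCoeff_C k⟩
  have hM := rTensor_exact M hex hsurj
  have h1 : (1 : K) = Algebra.linearMap K⟦X⟧ K 1 := by simp
  obtain ⟨y, hy⟩ := (hM ((1 : K⟦X⟧) ⊗ₜ x)).1 (by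
    rw [LinearMap.rTensor_tmul, ← h1]; exact hx)
  refine ⟨TensorProduct.lid _ _ y, ?_⟩
  have h2 : TensorProduct.lid K⟦X⟧ M (LinearMap.rTensor M
      (LinearMap.mulLeft K⟦X⟧ (PowerSeries.X : K⟦X⟧)) y) =
      (PowerSeries.X : K⟦X⟧) • TensorProduct.lid _ _ y := by
    clear hy
    induction y with
    | zero => simp
    | add a b ha hb => simp only [map_add, ha, hb, smul_add]
    | tmul r m => simp [mul_smul]
  rw [← h2, hy]
  simp

/-- A basis of the special fibre of a complete torsion-free `K⟦X⟧`-module lifts to a basis of the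
module. Lifts of the basis vectors generate by completeness, and they satisfy no relation: the
coefficients of a relation are divisible by `X`, and torsion-freeness allows this factor to be
cancelled, so they are divisible by every power of `X`. -/
theorem exists_basis_lift {ι : Type*} [Finite ι]
    (hc : IsAdicComplete (Ideal.span {(PowerSeries.X : K⟦X⟧)}) M)
    (ht : Module.IsTorsionFree K⟦X⟧ M) (b : Basis ι K (K ⊗[K⟦X⟧] M)) :
    ∃ d : Basis ι K⟦X⟧ M, d.baseChange K = b := by
  cases nonempty_fintype ι
  have hsurj : Function.Surjective (algebraMap K⟦X⟧ K) := fun k =>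
    ⟨PowerSeries.C k, PowerSeries.constantCoeff_C k⟩
  choose d hd using fun i => TensorProduct.mk_surjective K⟦X⟧ M K hsurj (b i)
  simp only [TensorProduct.mk_apply] at hd
  have htmul : ∀ v : ι → K⟦X⟧, (1 : K) ⊗ₜ[K⟦X⟧] Fintype.linearCombination K⟦X⟧ d v =
      ∑ i, PowerSeries.constantCoeff (v i) • b i := fun v => by
    simp only [Fintype.linearCombination_apply, TensorProduct.tmul_sum, TensorProduct.tmul_smul,
      hd]
    rfl
  have hinj : Function.Injective (Fintype.linearCombination K⟦X⟧ d) := by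
    rw [injective_iff_map_eq_zero]
    have key : ∀ n (v : ι → K⟦X⟧), Fintype.linearCombination K⟦X⟧ d v = 0 →
        ∀ i, PowerSeries.X ^ n ∣ v i := by
      intro n
      induction n with
      | zero => simp
      | succ n ih =>
        intro v hv
        have h0 := htmul v
        rw [hv, TensorProduct.tmul_zero] at h0
        have h1 := fun i => PowerSeries.X_dvd_iff.2
          (Fintype.linearIndependent_iff.1 b.linearIndependent _ h0.symm i)
        choose w hw using h1
        have hw' : v = (PowerSeries.X : K⟦X⟧) • w := funext fun i => by simp [hw]
        rw [hw', map_smul, smul_eq_zero_iff_right PowerSeries.X_ne_zero] at hv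
        intro i
        rw [hw i, pow_succ']
        exact mul_dvd_mul_left _ (ih w hv i)
    intro v hv
    ext i m
    exact PowerSeries.X_pow_dvd_iff.1 (key (m + 1) v hv i) m m.lt_succ_self
  have hsur : Function.Surjective (Fintype.linearCombination K⟦X⟧ d) := by
    have := isAdicComplete_of_basis (I := Ideal.span {(PowerSeries.X : K⟦X⟧)})
      (Pi.basisFun K⟦X⟧ ι)
    refine surjective_of_mkQ_comp_surjective (I := Ideal.span {(PowerSeries.X : K⟦X⟧)}) fun q => ?_
    obtain ⟨y, rfl⟩ := Submodule.mkQ_surjective _ q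
    refine ⟨fun i => PowerSeries.C (b.repr ((1 : K) ⊗ₜ y) i), ?_⟩
    have h0 : (1 : K) ⊗ₜ[K⟦X⟧] (Fintype.linearCombination K⟦X⟧ d
        (fun i => PowerSeries.C (b.repr ((1 : K) ⊗ₜ y) i)) - y) = 0 := by
      rw [TensorProduct.tmul_sub, htmul, sub_eq_zero]
      simp only [PowerSeries.constantCoeff_C]
      exact b.sum_repr _
    obtain ⟨z, hz⟩ := exists_X_smul_of_one_tmul_eq_zero h0
    rw [LinearMap.comp_apply, Submodule.mkQ_apply, Submodule.mkQ_apply, Submodule.Quotient.eq, hz]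
    exact Submodule.smul_mem_smul (Ideal.mem_span_singleton_self _) trivial
  refine ⟨.ofEquivFun (LinearEquiv.ofBijective _ ⟨hinj, hsur⟩).symm, ?_⟩
  refine DFunLike.ext _ _ fun i => ?_
  classical
  have hi : Fintype.linearCombination K⟦X⟧ d (Pi.single i 1) = d i := by
    rw [Fintype.linearCombination_apply_single, one_smul]
  rw [Basis.baseChange_apply, ← hd, ← hi, Basis.coe_ofEquivFun, LinearEquiv.symm_symm]
  rfl

end Special

/-! ### Deformations and degenerations of structure constants -/

section Degenerates

variable {K : Type u} [Field K] {ι : Type*} [Fintype ι]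

/-- The counterpart of `DeformsTo` for structure constants: some point of the `GL(K⸨X⸩)`-orbit of
`α` has coordinates in `K⟦X⟧` and specializes to `β` at `X = 0`. -/
def Degenerates [DecidableEq ι] (β α : Matrix (ι × ι) ι K) : Prop :=
  ∃ c : Matrix (ι × ι) ι K⟦X⟧, c.map PowerSeries.constantCoeff = β ∧
    ∃ P Q : Matrix ι ι K⸨X⸩, P * Q = 1 ∧
      transport P Q ((α.map PowerSeries.C).map (algebraMap K⟦X⟧ K⸨X⸩)) =
        c.map (algebraMap K⟦X⟧ K⸨X⸩)

theorem Degenerates.refl [DecidableEq ι] (α : Matrix (ι × ι) ι K) : Degenerates α α := by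
  refine ⟨α.map PowerSeries.C, ?_, 1, 1, mul_one 1, transport_one _⟩
  ext
  simp

attribute [local instance] laurentAlgebra

theorem algebraMap_laurent :
    algebraMap K K⸨X⸩ = (algebraMap K⟦X⟧ K⸨X⸩).comp PowerSeries.C := by
  ext a
  simp [HahnSeries.algebraMap_apply]

omit [Fintype ι] in
theorem map_algebraMap_laurent (α : Matrix (ι × ι) ι K) :
    α.map (algebraMap K K⸨X⸩) = (α.map PowerSeries.C).map (algebraMap K⟦X⟧ K⸨X⸩) := by
  rw [algebraMap_laurent]
  rfl

variable {A : Type v} [NonUnitalRing A] [Module K A] [IsScalarTower K A A] [SMulCommClass K A A]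
  {B : Type v} [NonUnitalRing B] [Module K B] [IsScalarTower K B B] [SMulCommClass K B B]

section

attribute [local instance] evalZeroAlgebra

/-- A formal deformation of `B` is free over `K⟦X⟧`, and has a basis whose structure constants reduce
at `X = 0` to those of any prescribed basis of `B`. -/
theorem FormalDeformation.exists_basis (D : FormalDeformation K B) (b : Basis ι K B) :
    ∃ d : Basis ι K⟦X⟧ D.carrier,
      (structConst d).map PowerSeries.constantCoeff = structConst b := by
  obtain ⟨d, hd⟩ := exists_basis_lift D.complete D.torsionFree (b.map D.special.symm)
  refine ⟨d, ?_⟩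
  have h : b = (d.baseChange K).map D.special := by
    rw [hd]
    ext
    simp
  rw [h, structConst_map _ _ D.special_mul, structConst_baseChange]
  rfl

end

theorem DeformsTo.nonempty_equiv {κ : Type*} [Fintype κ] (h : DeformsTo K B A)
    (b : Basis ι K B) (a : Basis κ K A) : Nonempty (κ ≃ ι) := by
  obtain ⟨D, e, he⟩ := h
  obtain ⟨d, -⟩ := D.exists_basis b
  exact ⟨((a.baseChange K⸨X⸩).map e.symm).indexEquiv (d.baseChange K⸨X⸩)⟩

theorem DeformsTo.degenerates [DecidableEq ι] (h : DeformsTo K B A)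
    (b : Basis ι K B) (a : Basis ι K A) : Degenerates (structConst b) (structConst a) := by
  obtain ⟨D, e, he⟩ := h
  obtain ⟨d, hd⟩ := D.exists_basis b
  obtain ⟨P, Q, hPQ, h⟩ := exists_structConst_eq_transport (a.baseChange K⸨X⸩)
    ((d.baseChange K⸨X⸩).map e)
  refine ⟨structConst d, hd, P, Q, hPQ, ?_⟩
  rw [structConst_map _ _ he, structConst_baseChange, structConst_baseChange,
    map_algebraMap_laurent] at h
  exact h.symm

/-- The `R`-span of a family whose products are `R`-linear combinations of the family, with the
coefficients `c`. -/
def spanSubalgebra {R : Type*} [CommRing R] {M : Type*} [NonUnitalRing M] [Module R M]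
    [IsScalarTower R M M] [SMulCommClass R M M] (d : ι → M) (c : Matrix (ι × ι) ι R)
    (h : ∀ i j, d i * d j = ∑ k, c (i, j) k • d k) : NonUnitalSubalgebra R M :=
  { Submodule.span R (Set.range d) with
    mul_mem' := fun {x y} hx hy => by
      change x * y ∈ Submodule.span R (Set.range d)
      change x ∈ Submodule.span R (Set.range d) at hx
      change y ∈ Submodule.span R (Set.range d) at hy
      induction hx using Submodule.span_induction with
      | zero => simp
      | add a b _ _ ha hb => rw [add_mul]; exact add_mem ha hb
      | smul r a _ ha => rw [smul_mul_assoc]; exact Submodule.smul_mem _ _ ha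
      | mem a ha =>
        obtain ⟨i, rfl⟩ := ha
        induction hy using Submodule.span_induction with
        | zero => simp
        | add a b _ _ ha hb => rw [mul_add]; exact add_mem ha hb
        | smul r a _ ha => rw [mul_smul_comm]; exact Submodule.smul_mem _ _ ha
        | mem a ha =>
          obtain ⟨j, rfl⟩ := ha
          rw [h]
          exact Submodule.sum_mem _ fun k _ => Submodule.smul_mem _ _ (Submodule.subset_span ⟨k, rfl⟩) }

/-- If the structure constants of an `L`-basis lie in the subring `R` of `L`, then the `R`-span of the
basis is an `R`-algebra with the same structure constants. Associativity is inherited from `M`. -/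
theorem exists_basis_spanSubalgebra {R L : Type*} [CommRing R] [IsDomain R] [Field L]
    [Algebra R L] (hRL : Function.Injective (algebraMap R L))
    {M : Type w} [NonUnitalRing M] [Module L M] [Module R M]
    [IsScalarTower R L M] [IsScalarTower R M M] [SMulCommClass R M M]
    (d : Basis ι L M) {c : Matrix (ι × ι) ι R}
    (h : structConst d = c.map (algebraMap R L)) :
    ∃ (N : Type w) (_ : NonUnitalRing N) (_ : Module R N) (_ : IsScalarTower R N N)
      (_ : SMulCommClass R N N) (d' : Basis ι R N), structConst d' = c := by
  have : Module.IsTorsionFree R L := Module.isTorsionFree_iff_algebraMap_injective.2 hRL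
  have h' : ∀ i j, d i * d j = ∑ k, c (i, j) k • d k := fun i j => by
    rw [basis_mul_basis d, h]
    simp
  let d' : Basis ι R (spanSubalgebra d c h') := d.restrictScalars R
  have hd' : ∀ i, (d' i : M) = d i := Basis.restrictScalars_apply R d
  refine ⟨spanSubalgebra d c h', inferInstance, inferInstance, inferInstance, inferInstance,
    d', structConst_eq fun i j => Subtype.ext ?_⟩
  push_cast
  simp [hd', h']

/-- A degeneration of the structure constants of `A` to `β` yields a `K⟦X⟧`-lattice in `K⸨X⸩ ⊗ A`,
closed under multiplication, whose structure constants reduce to `β`.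

The lattice `N` is given as a type with its algebra structure, not as a subalgebra: as soon as
`evalZeroAlgebra` is an instance, `K⸨X⸩ ⊗ A` has competing `K⟦X⟧`-module structures. -/
theorem Degenerates.exists_lattice [DecidableEq ι] {β : Matrix (ι × ι) ι K} {a : Basis ι K A}
    (h : Degenerates β (structConst a)) :
    ∃ (N : Type (max u v)) (_ : NonUnitalRing N) (_ : Module K⟦X⟧ N) (_ : IsScalarTower K⟦X⟧ N N)
      (_ : SMulCommClass K⟦X⟧ N N) (d : Basis ι K⟦X⟧ N),
      (structConst d).map PowerSeries.constantCoeff = β ∧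
        IsoAlg K⸨X⸩ (K⸨X⸩ ⊗[K⟦X⟧] N) (K⸨X⸩ ⊗[K] A) := by
  obtain ⟨c, hc, P, Q, hPQ, h⟩ := h
  obtain ⟨d, hd⟩ := exists_basis_structConst_eq_transport (a.baseChange K⸨X⸩) hPQ
  rw [structConst_baseChange, map_algebraMap_laurent, h] at hd
  obtain ⟨N, _, _, _, _, d', hd'⟩ :=
    exists_basis_spanSubalgebra (IsFractionRing.injective K⟦X⟧ K⸨X⸩) d hd
  refine ⟨N, _, _, inferInstance, inferInstance, d', hd' ▸ hc,
    isoAlg_of_structConst_eq (d'.baseChange K⸨X⸩) d ?_⟩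
  rw [structConst_baseChange, hd', hd]

section

attribute [local instance] evalZeroAlgebra

theorem Degenerates.deformsTo [DecidableEq ι] {b : Basis ι K B} {a : Basis ι K A}
    (h : Degenerates (structConst b) (structConst a)) : DeformsTo K B A := by
  obtain ⟨N, _, _, _, _, d, hd, hN⟩ := h.exists_lattice
  obtain ⟨e, he⟩ : IsoAlg K (K ⊗[K⟦X⟧] N) B := by
    refine isoAlg_of_structConst_eq (d.baseChange K) b ?_
    rw [structConst_baseChange, ← hd]
    rfl
  have := Module.Free.of_basis d
  exact ⟨{ carrier := N
           complete := isAdicComplete_of_basis d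
           torsionFree := inferInstance
           special := e
           special_mul := he }, hN⟩

end

end Degenerates

/-! ### Transitivity of degeneration -/

section Trans

variable {K : Type u} [Field K] {ι : Type*} [Fintype ι] [DecidableEq ι]

theorem expand_injective {N : ℕ} (hN : N ≠ 0) :
    Function.Injective (PowerSeries.expand N hN : K⟦X⟧ →ₐ[K] K⟦X⟧) := fun f g h => by
  ext m
  rw [← PowerSeries.coeff_expand_mul N hN f, h, PowerSeries.coeff_expand_mul]

/-- The substitution `X ↦ X ^ N` extends from power series to Laurent series. -/
theorem exists_laurent_expand {N : ℕ} (hN : N ≠ 0) :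
    ∃ ψ : K⸨X⸩ →+* K⸨X⸩, ∀ f : K⟦X⟧,
      ψ (algebraMap K⟦X⟧ K⸨X⸩ f) = algebraMap K⟦X⟧ K⸨X⸩ (PowerSeries.expand N hN f) := by
  have h : Function.Injective
      ((algebraMap K⟦X⟧ K⸨X⸩).comp (PowerSeries.expand N hN : K⟦X⟧ →ₐ[K] K⟦X⟧).toRingHom) :=
    (IsFractionRing.injective K⟦X⟧ K⸨X⸩).comp (expand_injective hN)
  exact ⟨IsFractionRing.lift h, fun f => IsFractionRing.lift_algebraMap h f⟩

theorem exists_dvd_X_pow {s : K⟦X⟧} (hs : s ≠ 0) : ∃ M, s ∣ PowerSeries.X ^ M := by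
  obtain ⟨M, hM⟩ := IsDiscreteValuationRing.associated_pow_irreducible hs PowerSeries.X_irreducible
  exact ⟨M, hM.dvd⟩

omit [DecidableEq ι] in
theorem exists_common_denom (H H' : Matrix ι ι K⸨X⸩) :
    ∃ (s : K⟦X⟧) (G G' : Matrix ι ι K⟦X⟧), s ≠ 0 ∧
      algebraMap K⟦X⟧ K⸨X⸩ s • H = G.map (algebraMap K⟦X⟧ K⸨X⸩) ∧
      algebraMap K⟦X⟧ K⸨X⸩ s • H' = G'.map (algebraMap K⟦X⟧ K⸨X⸩) := by
  obtain ⟨s, hs⟩ := IsLocalization.exist_integer_multiples_of_finite (nonZeroDivisors K⟦X⟧)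
    (fun p : (ι × ι) ⊕ (ι × ι) => p.elim (fun q => H q.1 q.2) (fun q => H' q.1 q.2))
  choose g hg using hs
  refine ⟨s, .of fun i j => g (.inl (i, j)), .of fun i j => g (.inr (i, j)),
    nonZeroDivisors.coe_ne_zero s, ?_, ?_⟩
  · ext i j : 2
    simpa [Algebra.smul_def] using (hg (.inl (i, j))).symm
  · ext i j : 2
    simpa [Algebra.smul_def] using (hg (.inr (i, j))).symm

/-- Let `(H, H')` carry `β` to `d`, with `d` reducing to `γ`, and let `(P, Q)` carry `α` to `c`, with
`c` reducing to `β`. Substituting `X ^ N` for `X` in the second degeneration turns `c` into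
`β + X ^ N e` with `e` integral. The pair `(H, H')` carries this to `d` plus `X ^ N` times the
transport of `e`, and the last term is integral and divisible by `X` as soon as `N` exceeds the
order of the poles of `transport H H'`. -/
theorem Degenerates.trans {γ β α : Matrix (ι × ι) ι K} (h : Degenerates γ β)
    (h' : Degenerates β α) : Degenerates γ α := by
  obtain ⟨d, hd, H, H', hH, h⟩ := h
  obtain ⟨c, hc, P, Q, hP, h'⟩ := h'
  obtain ⟨s, G, G', hs, hG, hG'⟩ := exists_common_denom H H'
  -- `transport` has degree three in the pair of matrices, so `s ^ 3` clears its denominators.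
  obtain ⟨M, u, hu⟩ := exists_dvd_X_pow (mul_ne_zero (mul_ne_zero hs hs) hs)
  obtain ⟨ψ, hψ⟩ := exists_laurent_expand (K := K) M.succ_ne_zero
  set φ : K⟦X⟧ →ₐ[K] K⟦X⟧ := PowerSeries.expand M.succ M.succ_ne_zero with hφ
  set ρ := algebraMap K⟦X⟧ K⸨X⸩ with hρ
  have hX : ∀ p k, ∃ f : K⟦X⟧, c p k = PowerSeries.C (β p k) + PowerSeries.X * f := fun p k => by
    obtain ⟨f, hf⟩ := PowerSeries.X_dvd_iff (φ := c p k - PowerSeries.C (β p k)) |>.2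
      (by simp [← hc])
    exact ⟨f, by rw [← hf]; ring⟩
  choose e he using hX
  have hexp : c.map φ = β.map PowerSeries.C + (PowerSeries.X ^ (M + 1) : K⟦X⟧) •
      (Matrix.of e).map φ := by
    ext p k : 2
    simp [he, hφ, PowerSeries.expand_C]
  have hα : ((α.map PowerSeries.C).map ρ).map ψ = (α.map PowerSeries.C).map ρ := by
    ext p k : 2
    simp only [Matrix.map_apply]
    rw [hψ, PowerSeries.expand_C]
  have hcψ : (c.map ρ).map ψ = (c.map φ).map ρ :=
    Matrix.ext fun p k => hψ _
  have key : transport H H' ((c.map φ).map ρ) =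
      (d + (PowerSeries.X * u) • transport G G' ((Matrix.of e).map φ)).map ρ := by
    have h1 : (c.map φ).map ρ = (β.map PowerSeries.C).map ρ +
        ρ (PowerSeries.X ^ (M + 1)) • ((Matrix.of e).map φ).map ρ := by
      rw [hexp]
      ext p k : 2
      simp
    have h2 : (d + (PowerSeries.X * u) • transport G G' ((Matrix.of e).map φ)).map ρ =
        d.map ρ + ρ (PowerSeries.X * u) • (transport G G' ((Matrix.of e).map φ)).map ρ := by
      ext p k : 2
      simp
    rw [h1, h2, transport_add, h, transport_smul, transport_map, ← hG, ← hG', transport_smul_smul,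
      smul_smul, pow_succ', hu]
    congr 2
    simp only [map_mul]
    ring
  refine ⟨d + (PowerSeries.X * u) • transport G G' ((Matrix.of e).map φ), ?_, H * P.map ψ,
    Q.map ψ * H', ?_, ?_⟩
  · rw [← hd]
    ext p k
    simp
  · rw [Matrix.mul_assoc, ← Matrix.mul_assoc (P.map ψ), ← Matrix.map_mul, hP,
      Matrix.map_one _ (map_zero ψ) (map_one ψ), Matrix.one_mul, hH]
  · rw [← transport_transport, ← key, ← hcψ, ← h', transport_map, hα]

end Trans

/-! ### Orbit closures and antisymmetry -/

section Points

variable {K : Type u} [Field K] [IsAlgClosed K]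

/-- The weak Nullstellensatz: a nonempty affine scheme of finite type over an algebraically closed
field has a rational point. -/
theorem nonempty_algHom_of_finiteType (T : Type*) [CommRing T] [Algebra K T]
    [Algebra.FiniteType K T] [Nontrivial T] : Nonempty (T →ₐ[K] K) := by
  obtain ⟨m, hm⟩ := Ideal.exists_maximal T
  let _ : Field (T ⧸ m) := Ideal.Quotient.field m
  have := finite_of_finite_type_of_isJacobsonRing K (T ⧸ m)
  let e : K ≃ₐ[K] T ⧸ m := AlgEquiv.ofBijective (Algebra.ofId K (T ⧸ m))
    IsAlgClosed.algebraMap_bijective_of_isIntegral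
  exact ⟨(e.symm : (T ⧸ m) →ₐ[K] K).comp (Ideal.Quotient.mkₐ K m)⟩

/-- The rational points of an integral variety over an algebraically closed field are dense. -/
theorem exists_algHom_apply_ne_zero {S : Type*} [CommRing S] [IsDomain S] [Algebra K S]
    [Algebra.FiniteType K S] {s : S} (hs : s ≠ 0) : ∃ e : S →ₐ[K] K, e s ≠ 0 := by
  have := IsLocalization.injective (Localization.Away s)
    (powers_le_nonZeroDivisors_of_noZeroDivisors hs)
  have : Nontrivial (Localization.Away s) := this.nontrivial
  have : Algebra.FiniteType S (Localization.Away s) := IsLocalization.finiteType_of_monoid_fg (.powers s) _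
  have : Algebra.FiniteType K (Localization.Away s) := .trans (S := S) inferInstance this
  obtain ⟨e⟩ := nonempty_algHom_of_finiteType (K := K) (Localization.Away s)
  refine ⟨e.comp (IsScalarTower.toAlgHom K S _), ?_⟩
  exact ((IsLocalization.Away.algebraMap_isUnit (S := Localization.Away s) s).map e).ne_zero

/-- Two morphisms from integral affine varieties to the same affine scheme whose images have the same
closure have a common point in their images. Let `R` be the coordinate ring of the common
closure. The fibre product has coordinate ring `S₁ ⊗[R] S₂`; it is not zero, as becomes visible over
the fraction field of `R`, and so it has a rational point. -/
theorem exists_algHom_comp_eq {A S₁ S₂ : Type*} [CommRing A] [Algebra K A]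
    [CommRing S₁] [IsDomain S₁] [Algebra K S₁] [Algebra.FiniteType K S₁]
    [CommRing S₂] [IsDomain S₂] [Algebra K S₂] [Algebra.FiniteType K S₂]
    (f : A →ₐ[K] S₁) (g : A →ₐ[K] S₂) (h : RingHom.ker f = RingHom.ker g) :
    ∃ (e₁ : S₁ →ₐ[K] K) (e₂ : S₂ →ₐ[K] K), e₁.comp f = e₂.comp g := by
  let R := A ⧸ RingHom.ker f
  let f' : R →ₐ[K] S₁ := Ideal.Quotient.liftₐ _ f fun a ha => ha
  let g' : R →ₐ[K] S₂ := Ideal.Quotient.liftₐ _ g fun a ha => by rwa [h] at ha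
  have hf' : Function.Injective f' := RingHom.lift_injective_of_ker_le_ideal _ _ le_rfl
  have hg' : Function.Injective g' := RingHom.lift_injective_of_ker_le_ideal _ _ h.ge
  algebraize [f'.toRingHom, g'.toRingHom]
  have : IsScalarTower K R S₁ := .of_algHom f'
  have : IsScalarTower K R S₂ := .of_algHom g'
  have : Nontrivial (S₁ ⊗[R] S₂) :=
    Algebra.TensorProduct.nontrivial_of_algebraMap_injective_of_isDomain R S₁ S₂ hf' hg'
  have : Algebra.FiniteType R S₂ := .of_restrictScalars_finiteType K R S₂
  have : Algebra.FiniteType S₁ (S₁ ⊗[R] S₂) := inferInstance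
  have : Algebra.FiniteType K (S₁ ⊗[R] S₂) := .trans (S := S₁) inferInstance this
  obtain ⟨e⟩ := nonempty_algHom_of_finiteType (K := K) (S₁ ⊗[R] S₂)
  refine ⟨e.comp (Algebra.TensorProduct.includeLeft : S₁ →ₐ[K] S₁ ⊗[R] S₂),
    e.comp ((Algebra.TensorProduct.includeRight : S₂ →ₐ[R] S₁ ⊗[R] S₂).restrictScalars K),
    AlgHom.ext fun a => ?_⟩
  have h1 : (f a ⊗ₜ[R] (1 : S₂)) = (1 : S₁) ⊗ₜ[R] g a := by
    exact Algebra.TensorProduct.tmul_one_eq_one_tmul (Ideal.Quotient.mk _ a : R)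
  exact congrArg e h1

end Points

section OrbitMap

variable {K : Type u} [Field K] {ι : Type*} [Fintype ι] [DecidableEq ι]

/-- The `T`-point `c` of the affine space of structure constants, as a homomorphism from the polynomial
ring in the coordinates. -/
noncomputable def coordEval {T : Type*} [CommRing T] [Algebra K T] (c : Matrix (ι × ι) ι T) :
    MvPolynomial ((ι × ι) × ι) K →ₐ[K] T :=
  MvPolynomial.aeval fun p => c p.1 p.2

omit [Fintype ι] [DecidableEq ι] in
theorem comp_coordEval {T T' : Type*} [CommRing T] [Algebra K T] [CommRing T'] [Algebra K T']
    (g : T →ₐ[K] T') (c : Matrix (ι × ι) ι T) :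
    g.comp (coordEval c) = coordEval (c.map g) :=
  MvPolynomial.algHom_ext fun p => by simp [coordEval]

omit [Fintype ι] [DecidableEq ι] in
theorem coordEval_injective {T : Type*} [CommRing T] [Algebra K T] :
    Function.Injective (coordEval : Matrix (ι × ι) ι T → _ →ₐ[K] T) := fun c d h => by
  ext p k
  simpa [coordEval] using DFunLike.congr_fun h (MvPolynomial.X (p, k))

variable (K ι) in
/-- The coordinate ring of `GL`. -/
abbrev GLRing : Type _ := Localization.Away (Matrix.mvPolynomialX ι ι K).det

variable (K ι) in
/-- The universal invertible matrix. -/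
noncomputable def genMatrix : Matrix ι ι (GLRing K ι) :=
  (Matrix.mvPolynomialX ι ι K).map (algebraMap (MvPolynomial (ι × ι) K) (GLRing K ι))

theorem isUnit_det_genMatrix : IsUnit (genMatrix K ι).det := by
  have h := IsLocalization.Away.algebraMap_isUnit (S := GLRing K ι) (Matrix.mvPolynomialX ι ι K).det
  rwa [RingHom.map_det] at h

theorem genMatrix_mul_inv : genMatrix K ι * (genMatrix K ι)⁻¹ = 1 :=
  Matrix.mul_nonsing_inv _ isUnit_det_genMatrix

instance : IsDomain (GLRing K ι) :=
  IsLocalization.isDomain_localization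
    (powers_le_nonZeroDivisors_of_noZeroDivisors (Matrix.det_mvPolynomialX_ne_zero ι K))

instance : Algebra.FiniteType K (GLRing K ι) :=
  .trans (S := MvPolynomial (ι × ι) K) inferInstance
    (IsLocalization.finiteType_of_monoid_fg (.powers (Matrix.mvPolynomialX ι ι K).det) _)

/-- Every invertible matrix over a `K`-algebra is a specialization of `genMatrix`. -/
theorem exists_algHom_genMatrix {T : Type*} [CommRing T] [Algebra K T] {P Q : Matrix ι ι T}
    (h : P * Q = 1) :
    ∃ e : GLRing K ι →ₐ[K] T, (genMatrix K ι).map e = P ∧ ((genMatrix K ι)⁻¹).map e = Q := by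
  let f : MvPolynomial (ι × ι) K →ₐ[K] T := MvPolynomial.aeval fun p => P p.1 p.2
  have hf : (Matrix.mvPolynomialX ι ι K).map f = P := by
    ext i j
    simp [f]
  have hdet : IsUnit (f (Matrix.mvPolynomialX ι ι K).det) := by
    rw [AlgHom.map_det]
    change IsUnit ((Matrix.mvPolynomialX ι ι K).map f).det
    rw [hf]
    exact .of_mul_eq_one Q.det (by rw [← Matrix.det_mul, h, Matrix.det_one])
  have hu : ∀ y : Submonoid.powers (Matrix.mvPolynomialX ι ι K).det, IsUnit (f y) := by
    rintro ⟨_, n, rfl⟩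
    simpa using hdet.pow n
  let e : GLRing K ι →ₐ[K] T := IsLocalization.liftAlgHom hu
  have he : (genMatrix K ι).map e = P := by
    rw [← hf]
    ext i j
    simp [genMatrix, e]
  refine ⟨e, he, ?_⟩
  have h1 : P * ((genMatrix K ι)⁻¹).map e = 1 := by
    rw [← he, ← Matrix.map_mul, genMatrix_mul_inv, Matrix.map_one _ (map_zero e) (map_one e)]
  calc ((genMatrix K ι)⁻¹).map e = (Q * P) * ((genMatrix K ι)⁻¹).map e := by
        rw [mul_eq_one_comm.1 h, Matrix.one_mul]
    _ = Q := by rw [Matrix.mul_assoc, h1, Matrix.mul_one]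

/-- The comorphism of the orbit map `g ↦ g • α` of `GL`. Its kernel is the ideal of the orbit
closure. -/
noncomputable def orbitMap (α : Matrix (ι × ι) ι K) :
    MvPolynomial ((ι × ι) × ι) K →ₐ[K] GLRing K ι :=
  coordEval (transport (genMatrix K ι) (genMatrix K ι)⁻¹ (α.map (algebraMap K (GLRing K ι))))

theorem comp_orbitMap {T : Type*} [CommRing T] [Algebra K T] (e : GLRing K ι →ₐ[K] T)
    (α : Matrix (ι × ι) ι K) :
    e.comp (orbitMap α) = coordEval (transport ((genMatrix K ι).map e)
      (((genMatrix K ι)⁻¹).map e) (α.map (algebraMap K T))) := by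
  rw [orbitMap, comp_coordEval]
  congr 1
  refine (transport_map e.toRingHom _ _ _).trans ?_
  congr 1
  ext p k
  simp

attribute [local instance] laurentAlgebra

/-- If `α` degenerates to `β`, then every polynomial `f` vanishing on the orbit of `α` vanishes on
that of `β`. For a rational point `G` of `GL`, the product of `G` with the matrix that carries `α` to
`c` is a `K⸨X⸩`-point of `GL`, hence `f` vanishes at the transport of `c` along `G`; that point has
coordinates in `K⟦X⟧`, and `X = 0` gives the transport of `β`. A polynomial vanishing at all rational
points of the orbit of `β` lies in the kernel, since `GLRing` is a domain of finite type. -/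
theorem Degenerates.ker_orbitMap_le [IsAlgClosed K] {β α : Matrix (ι × ι) ι K}
    (h : Degenerates β α) : RingHom.ker (orbitMap α) ≤ RingHom.ker (orbitMap β) := by
  obtain ⟨c, hc, P, Q, hPQ, h⟩ := h
  intro f hf
  by_contra hne
  obtain ⟨e, he⟩ := exists_algHom_apply_ne_zero (K := K) (s := orbitMap β f) hne
  refine he ?_
  set G := (genMatrix K ι).map e with hG
  set G' := ((genMatrix K ι)⁻¹).map e with hG'
  have hGG : G * G' = 1 := by
    rw [hG, hG', ← Matrix.map_mul, genMatrix_mul_inv, Matrix.map_one _ (map_zero e) (map_one e)]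
  let ρ : K⟦X⟧ →ₐ[K] K⸨X⸩ :=
    { algebraMap K⟦X⟧ K⸨X⸩ with
      commutes' := fun a => by rw [algebraMap_laurent]; rfl }
  let ε : K⟦X⟧ →ₐ[K] K :=
    { (PowerSeries.constantCoeff : K⟦X⟧ →+* K) with
      commutes' := fun a => PowerSeries.constantCoeff_C a }
  have hρ : Function.Injective ρ := IsFractionRing.injective K⟦X⟧ K⸨X⸩
  have hC : (G.map PowerSeries.C) * (G'.map PowerSeries.C) = 1 := by
    rw [← Matrix.map_mul, hGG, Matrix.map_one _ (map_zero _) (map_one _)]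
  -- `c'` is an integral point at which `f` vanishes, and its reduction is the transport of `β`.
  set c' := transport (G.map PowerSeries.C) (G'.map PowerSeries.C) c with hc'
  have h1 : coordEval (K := K) c' f = 0 := by
    refine hρ ?_
    obtain ⟨e', he', he''⟩ := exists_algHom_genMatrix (K := K)
      (P := (G.map PowerSeries.C).map (algebraMap K⟦X⟧ K⸨X⸩) * P)
      (Q := Q * (G'.map PowerSeries.C).map (algebraMap K⟦X⟧ K⸨X⸩)) (by
        rw [Matrix.mul_assoc, ← Matrix.mul_assoc P, hPQ, Matrix.one_mul, ← Matrix.map_mul, hC,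
          Matrix.map_one _ (map_zero _) (map_one _)])
    have h2 := comp_orbitMap e' α
    rw [he', he'', ← transport_transport, map_algebraMap_laurent, h, ← transport_map] at h2
    have h3 := comp_coordEval ρ c'
    rw [map_zero, ← AlgHom.comp_apply, h3]
    refine (DFunLike.congr_fun h2 f).symm.trans ?_
    rw [AlgHom.comp_apply, (show orbitMap α f = 0 from hf), map_zero]
  have h4 : c'.map ε = transport G G' β := by
    refine (transport_map ε.toRingHom _ _ _).trans ?_
    have hε : c.map ε.toRingHom = β := hc
    rw [hε]
    congr 1
  have h5 : e.comp (orbitMap β) = ε.comp (coordEval c') := by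
    rw [comp_orbitMap, comp_coordEval, h4]
    rfl
  rw [← AlgHom.comp_apply, h5, AlgHom.comp_apply, h1, map_zero]

/-- Structure constants that degenerate to each other have the same orbit closure, so their orbits
meet, and hence are equal. -/
theorem Degenerates.exists_transport_eq [IsAlgClosed K] {β α : Matrix (ι × ι) ι K}
    (h : Degenerates β α) (h' : Degenerates α β) :
    ∃ P Q : Matrix ι ι K, P * Q = 1 ∧ transport P Q α = β := by
  obtain ⟨e₁, e₂, he⟩ := exists_algHom_comp_eq (orbitMap α) (orbitMap β)
    (le_antisymm h.ker_orbitMap_le h'.ker_orbitMap_le)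
  rw [comp_orbitMap, comp_orbitMap] at he
  have key := coordEval_injective he
  have h₁ : (genMatrix K ι).map e₁ * ((genMatrix K ι)⁻¹).map e₁ = 1 := by
    rw [← Matrix.map_mul, genMatrix_mul_inv, Matrix.map_one _ (map_zero _) (map_one _)]
  have h₂ : (genMatrix K ι).map e₂ * ((genMatrix K ι)⁻¹).map e₂ = 1 := by
    rw [← Matrix.map_mul, genMatrix_mul_inv, Matrix.map_one _ (map_zero _) (map_one _)]
  refine ⟨((genMatrix K ι)⁻¹).map e₂ * (genMatrix K ι).map e₁,
    ((genMatrix K ι)⁻¹).map e₁ * (genMatrix K ι).map e₂, ?_, ?_⟩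
  · rw [Matrix.mul_assoc, ← Matrix.mul_assoc ((genMatrix K ι).map e₁), h₁, Matrix.one_mul,
      mul_eq_one_comm.1 h₂]
  · have hid : ∀ γ : Matrix (ι × ι) ι K, γ.map (algebraMap K K) = γ := fun γ => rfl
    rw [hid, hid] at key
    rw [← transport_transport, key, transport_transport, mul_eq_one_comm.1 h₂, transport_one]

end OrbitMap

/-! ### The partial order -/

section Order

variable {K : Type u} [Field K]
  {A : Type v} [NonUnitalRing A] [Module K A] [IsScalarTower K A A] [SMulCommClass K A A]
  {B : Type v} [NonUnitalRing B] [Module K B] [IsScalarTower K B B] [SMulCommClass K B B]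
  {C : Type v} [NonUnitalRing C] [Module K C] [IsScalarTower K C C] [SMulCommClass K C C]

theorem DeformsTo.refl [FiniteDimensional K A] : DeformsTo K A A :=
  Degenerates.deformsTo (b := finBasis K A) (a := finBasis K A) (.refl _)

/-- Algebras related by `DeformsTo` have the same dimension. -/
theorem DeformsTo.exists_basis [FiniteDimensional K A] (h : DeformsTo K B A) {ι : Type*}
    [Fintype ι] (b : Basis ι K B) : Nonempty (Basis ι K A) :=
  (h.nonempty_equiv b (finBasis K A)).map (finBasis K A).reindex

theorem DeformsTo.trans [FiniteDimensional K A] [FiniteDimensional K B] [FiniteDimensional K C]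
    (h : DeformsTo K C B) (h' : DeformsTo K B A) : DeformsTo K C A := by
  let c := finBasis K C
  obtain ⟨b⟩ := h.exists_basis c
  obtain ⟨a⟩ := h'.exists_basis b
  exact ((h.degenerates c b).trans (h'.degenerates b a)).deformsTo

theorem DeformsTo.isoAlg [IsAlgClosed K] [FiniteDimensional K A] [FiniteDimensional K B]
    (h : DeformsTo K B A) (h' : DeformsTo K A B) : IsoAlg K B A := by
  let b := finBasis K B
  obtain ⟨a⟩ := h.exists_basis b
  obtain ⟨P, Q, hPQ, hP⟩ := (h.degenerates b a).exists_transport_eq (h'.degenerates a b)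
  obtain ⟨d, hd⟩ := exists_basis_structConst_eq_transport a hPQ
  exact isoAlg_of_structConst_eq b d (hP.symm.trans hd.symm)

end Order
end AssocDeformation

theorem mainTheorem7 (K : Type u) [Field K] [IsAlgClosed K] :
    IsPartialOrder (AssocDeformation.IsoClass.{u, v} K) AssocDeformation.IsoClass.le where
  refl := by
    rintro ⟨A⟩
    exact AssocDeformation.DeformsTo.refl
  trans := by
    rintro ⟨C⟩ ⟨B⟩ ⟨A⟩ h h'
    exact AssocDeformation.DeformsTo.trans h h'
  antisymm := by
    rintro ⟨B⟩ ⟨A⟩ h h'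
    exact Quotient.sound (AssocDeformation.DeformsTo.isoAlg h h')
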